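/- **Setting.** All probability spaces are complete and countably additive. Let $(I,\mathcal I,\lambda)$ be an atomless probability space (players), $A$ a nonempty finite set (actions), and $\Delta$ the simplex of probability distributions on $A$. Let $\mathcal U$ be the space of continuous real functions on $A\times\Delta$ with the sup norm and its Borel $\sigma$-algebra. A *large game* is a measurable map $i\mapsto u_i$ from $I$ to $\mathcal U$. Let $(\Omega,\mathcal F,\mathbb P)$ be a probability space such that $I$ and $\Omega$ admit a rich Fubini extension $(I\times\Omega,\mathcal W,\mathbb Q)$, fixed from now on. That is, $(I\times\Omega,\mathcal W,\mathbb Q)$ is a probability space extending the usual product; for every $\mathbb Q$-integrable $f:I\times\Omega\to\mathbb R$ almost all sections of $f$ are integrable, the two partial integrals are integrable, and both iterated integrals equal $\int f\,d\mathbb Q$; and there is a $\mathcal W$-measurable process $I\times\Omega\to[0,1]$ whose random variables are uniformly distributed on $[0,1]$ and essentially pairwise independent. Here a process $(g_i)_{i\in I}$ is *essentially pairwise independent* if for $\lambda$-almost all $i$, $g_i$ and $g_j$ are independent for $\lambda$-almost all $j$. A (mixed) *strategy* is a measurable map $\xi:\Omega\to A$. A (mixed) *strategy profile* is a $\mathcal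 W$-measurable, essentially pairwise independent $g:I\times\Omega\to A$; write $g_i=g(i,\cdot)$, $g_\omega=g(\cdot,\omega)$, and $s(g_\omega)=\lambda g_\omega^{-1}\in\Delta$. A *pure strategy profile* is a measurable map $f:I\to A$; it is identified with the degenerate mixed profile $(i,\omega)\mapsto f(i)$. For a Borel probability measure $\nu$ on $\Delta$ put $u_i(a,\nu)=\int_\Delta u_i(a,\tau)\,d\nu(\tau)$. A *perturbation function* is a Borel measurable map $\varphi$ from $\Delta$ to the Borel probability measures of full support on $\Delta$ (with the topology of weak convergence). **Definitions.** Let $g$ be a strategy profile. * $g$ is a *Nash equilibrium* if for $\lambda$-almost all $i$ and every strategy $\xi$, $\int_\Omega u_i(g_i(\omega),s(g_\omega))\,d\mathbb P(\omega)\ge\int_\Omega u_i(\xi(\omega),s(g_\omega))\,d\mathbb P(\omega)$. * An action $a$ is *weakly dominated* for player $i$ if there is a strategy $\xi$ with $u_i(a,\tau)\le\int_\Omega u_i(\xi(\omega),\tau)\,d\mathbb P(\omega)$ for all $\tau\in\Delta$, with strict inequality for some $\tau$. $g$ is *admissible* if for $\lambda$-almost all $i$, $\mathbb P g_i^{-1}$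 gives probability zero to every action weakly dominated for $i$. * $g$ is *aggregate robust* if for $\lambda$-almost all $i$ there are perturbation functions $\varphi^n$, $n\ge 1$, such that $\varphi^n(\tau)\to\delta_\tau$ weakly for every $\tau\in\Delta$ and, for every $n$ and every strategy $\xi$, $\int_\Omega u_i\bigl(g_i(\omega),\varphi^n(s(g_\omega))\bigr)\,d\mathbb P(\omega)\ge\int_\Omega u_i\bigl(\xi(\omega),\varphi^n(s(g_\omega))\bigr)\,d\mathbb P(\omega)$. * $g$ is an *$\varepsilon$-robust perfect equilibrium* associated with a measurable set $J\subseteq I$ and a perturbation function $\varphi$ if: $\mathbb P g_i^{-1}$ has full support on $A$ for $\lambda$-almost all $i$; $\lambda(J)>1-\varepsilon$; $\varphi(\tau)(\{\tau\})\ge1-\varepsilon$ for all $\tau\in\Delta$; and for all $i\in J$ and $a,b\in A$, if $\int_\Omega u_i\bigl(a,\varphi(s(g_\omega))\bigr)\,d\mathbb P(\omega)<\int_\Omega u_i\bigl(b,\varphi(s(g_\omega))\bigr)\,d\mathbb P(\omega)$, then $\mathbb P g_i^{-1}(\{a\})\le\varepsilon$. * $g$ is a *robust perfect equilibrium* if there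 are strategy profiles $g^n$ and reals $\varepsilon_n>0$ with $\varepsilon_n\to0$ such that (i) each $g^n$ is an $\varepsilon_n$-robust perfect equilibrium associated with some $I^n$ and $\varphi^n$; (ii) for $\lambda$-almost all $i$ there is a subsequence $(n_k)$ with $i\in\bigcap_k I^{n_k}$ and $\mathbb P(g_i^{n_k})^{-1}\to\mathbb P g_i^{-1}$; (iii) $\int_I\mathbb P(g_i^n)^{-1}\,d\lambda(i)\to\int_I\mathbb P g_i^{-1}\,d\lambda(i)$. A pure strategy profile is a *pure strategy robust perfect equilibrium* if the corresponding degenerate mixed profile is a robust perfect equilibrium. **Theorem.** Every robust perfect equilibrium $g$ of a large game is admissible and aggregate robust. Moreover: 1. for $\mathbb P$-almost every $\omega\in\Omega$, the realized profile $g_\omega:I\to A$ is a pure strategy robust perfect equilibrium; 2. $g$ is a Nash equilibrium. -/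

import Mathlib

open MeasureTheory ProbabilityTheory Filter Topology

noncomputable section

namespace LargeGame

universe u v w

variable {I : Type u} {Ω : Type v} {A : Type w}

/-- A measure space has no atoms: every measurable set of positive measure has a measurable
subset of strictly smaller positive measure. -/
def Atomless [MeasurableSpace I] (lam : Measure I) : Prop :=
  ∀ E : Set I, MeasurableSet E → 0 < lam E →
    ∃ F ⊆ E, MeasurableSet F ∧ 0 < lam F ∧ lam F < lam E

/-! ### Fubini extensions -/

/-- A Fubini extension of the product of the probability spaces `(I, lam)` and `(Ω, P)`: a complete
probability space on `I × Ω` that extends the usual product and has the Fubini property. -/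
structure FubiniExtension [MeasurableSpace I] [MeasurableSpace Ω]
    (lam : Measure I) (P : Measure Ω) where
  /-- the extended σ-algebra on `I × Ω` -/
  W : MeasurableSpace (I × Ω)
  /-- the extended measure on `I × Ω` -/
  Q : @Measure (I × Ω) W
  isProbabilityMeasure : IsProbabilityMeasure Q
  isComplete : Q.IsComplete
  prod_le : (Prod.instMeasurableSpace : MeasurableSpace (I × Ω)) ≤ W
  extends_prod : ∀ s : Set (I × Ω), MeasurableSet[Prod.instMeasurableSpace] s →
    Q s = (lam.prod P) s
  integrable_left : ∀ f : I × Ω → ℝ, Integrable f Q → ∀ᵐ i ∂lam, Integrable (fun ω => f (i, ω)) P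
  integrable_right : ∀ f : I × Ω → ℝ, Integrable f Q →
    ∀ᵐ ω ∂P, Integrable (fun i => f (i, ω)) lam
  integrable_integral_left : ∀ f : I × Ω → ℝ, Integrable f Q →
    Integrable (fun i => ∫ ω, f (i, ω) ∂P) lam
  integrable_integral_right : ∀ f : I × Ω → ℝ, Integrable f Q →
    Integrable (fun ω => ∫ i, f (i, ω) ∂lam) P
  integral_eq_left : ∀ f : I × Ω → ℝ, Integrable f Q →
    ∫ p, f p ∂Q = ∫ i, ∫ ω, f (i, ω) ∂P ∂lam
  integral_eq_right : ∀ f : I × Ω → ℝ, Integrable f Q →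
    ∫ p, f p ∂Q = ∫ ω, ∫ i, f (i, ω) ∂lam ∂P

/-- Essential pairwise independence of a process `f : I × Ω → X`: for almost all `i`, the random
variables `f (i, ·)` and `f (j, ·)` are independent for almost all `j`. -/
def EssPairwiseIndep {X : Type*} [MeasurableSpace X] [MeasurableSpace I] [MeasurableSpace Ω]
    (lam : Measure I) (P : Measure Ω) (f : I × Ω → X) : Prop :=
  ∀ᵐ i ∂lam, ∀ᵐ j ∂lam, IndepFun (fun ω => f (i, ω)) (fun ω => f (j, ω)) P

section Fubini

variable [MeasurableSpace I] [MeasurableSpace Ω] {lam : Measure I} {P : Measure Ω}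

/-- A Fubini extension is rich if it carries a measurable process of essentially pairwise
independent random variables that are uniformly distributed on `[0, 1]`. -/
def FubiniExtension.IsRich (F : FubiniExtension lam P) : Prop :=
  ∃ η : I × Ω → unitInterval, Measurable[F.W] η ∧
    (∀ᵐ i ∂lam, P.map (fun ω => η (i, ω)) = volume) ∧ EssPairwiseIndep lam P η

end Fubini

/-! ### Actions, payoffs, strategies -/

/-- The simplex of probability distributions on the finite action set `A`. -/
abbrev Dist (A : Type w) [Fintype A] : Type w := ↥(stdSimplex ℝ A)

/-- The space of continuous payoff functions on `A × Dist A`; its compact-open topology is the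
sup-norm topology, since `A × Dist A` is compact. -/
abbrev Payoff (A : Type w) [Fintype A] [TopologicalSpace A] : Type w := C(A × Dist A, ℝ)

/-- A large game is a map from players to payoffs, measurable for the Borel σ-algebra of the
space of payoffs. -/
def IsLargeGame [MeasurableSpace I] [Fintype A] [TopologicalSpace A] (u : I → Payoff A) : Prop :=
  @Measurable I (Payoff A) _ (borel (Payoff A)) u

/-- The societal summary of a pure strategy profile `f`: its action distribution. The value for a
map `f` that is not measurable is irrelevant. -/
def summary [MeasurableSpace I] (lam : Measure I) [IsProbabilityMeasure lam]
    [Fintype A] [Nonempty A] [MeasurableSpace A] [DiscreteMeasurableSpace A] (f : I → A) :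
    Dist A :=
  open Classical in
  if h : Measurable f then
    ⟨fun a => lam.real (f ⁻¹' {a}), fun _ => measureReal_nonneg, by
      rw [sum_measureReal_preimage_singleton _ (fun a _ => h (measurableSet_singleton a))]
      simp⟩
  else ⟨Pi.single (Classical.arbitrary A) 1, single_mem_stdSimplex ℝ _⟩

/-- The distribution of the random action of player `i` under `g`, as a vector indexed by the
actions. -/
def actionLaw [MeasurableSpace Ω] (P : Measure Ω) (g : I × Ω → A) (i : I) : A → ℝ :=
  fun a => P.real {ω | g (i, ω) = a}

/-- The payoff `u(a, ν)` of the action `a` against a probability distribution `ν` over societal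
summaries. -/
def payoffAgainst [Fintype A] [TopologicalSpace A] (u : Payoff A) (a : A)
    (ν : ProbabilityMeasure (Dist A)) : ℝ :=
  ∫ τ, u (a, τ) ∂(ν : Measure (Dist A))

/-- A perturbation function: a Borel measurable map from the simplex to the probability measures
of full support on the simplex, with the topology of weak convergence. -/
def IsPerturbation [Fintype A] (φ : Dist A → ProbabilityMeasure (Dist A)) : Prop :=
  @Measurable (Dist A) (ProbabilityMeasure (Dist A)) _ (borel _) φ ∧
    ∀ τ, (φ τ : Measure (Dist A)).IsOpenPosMeasure

section Profiles

variable [MeasurableSpace I] [MeasurableSpace Ω] {lam : Measure I} {P : Measure Ω}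
  [IsProbabilityMeasure lam]
  [Fintype A] [Nonempty A] [TopologicalSpace A]
  [MeasurableSpace A] [DiscreteMeasurableSpace A]

/-- A mixed strategy profile. -/
def IsStrategyProfile (F : FubiniExtension lam P) (g : I × Ω → A) : Prop :=
  Measurable[F.W] g ∧ EssPairwiseIndep lam P g

/-- A mixed strategy profile is a Nash equilibrium. -/
def IsNash (F : FubiniExtension lam P) (u : I → Payoff A) (g : I × Ω → A) : Prop :=
  IsStrategyProfile F g ∧
  ∀ᵐ i ∂lam, ∀ ξ : Ω → A, Measurable ξ →
    ∫ ω, u i (ξ ω, summary lam (fun j => g (j, ω))) ∂P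
      ≤ ∫ ω, u i (g (i, ω), summary lam (fun j => g (j, ω))) ∂P

/-- The pure strategy `a` is weakly dominated, for the payoff `u`, by some mixed strategy. -/
def WeaklyDominated (P : Measure Ω) (u : Payoff A) (a : A) : Prop :=
  ∃ ξ : Ω → A, Measurable ξ ∧
    (∀ τ : Dist A, u (a, τ) ≤ ∫ ω, u (ξ ω, τ) ∂P) ∧
    ∃ τ : Dist A, u (a, τ) < ∫ ω, u (ξ ω, τ) ∂P

/-- Admissibility of a strategy profile. -/
def IsAdmissible (F : FubiniExtension lam P) (u : I → Payoff A) (g : I × Ω → A) : Prop :=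
  IsStrategyProfile F g ∧
  ∀ᵐ i ∂lam, ∀ a : A, WeaklyDominated P (u i) a → actionLaw P g i a = 0

/-- Aggregate robustness of a strategy profile. -/
def IsAggregateRobust (F : FubiniExtension lam P) (u : I → Payoff A) (g : I × Ω → A) : Prop :=
  IsStrategyProfile F g ∧
  ∀ᵐ i ∂lam, ∃ φ : ℕ → Dist A → ProbabilityMeasure (Dist A),
    (∀ n, IsPerturbation (φ n)) ∧
    (∀ τ, Tendsto (fun n => φ n τ) atTop (𝓝 (diracProba τ))) ∧
    ∀ n, ∀ ξ : Ω → A, Measurable ξ →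
      ∫ ω, payoffAgainst (u i) (ξ ω) (φ n (summary lam (fun j => g (j, ω)))) ∂P
        ≤ ∫ ω, payoffAgainst (u i) (g (i, ω)) (φ n (summary lam (fun j => g (j, ω)))) ∂P

/-- `g` is an `ε`-robust perfect equilibrium associated with the perturbed player space `J` and
the perturbation function `φ`. -/
structure IsEpsRobustPerfectWith (F : FubiniExtension lam P) (u : I → Payoff A)
    (g : I × Ω → A) (ε : ℝ) (J : Set I) (φ : Dist A → ProbabilityMeasure (Dist A)) : Prop where
  isStrategyProfile : IsStrategyProfile F g
  fullSupport : ∀ᵐ i ∂lam, ∀ a : A, 0 < actionLaw P g i a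
  measurableSet : MeasurableSet J
  isPerturbation : IsPerturbation φ
  measure_gt : 1 - ε < lam.real J
  weight : ∀ τ, 1 - ε ≤ (φ τ : Measure (Dist A)).real {τ}
  rational : ∀ i ∈ J, ∀ a b : A,
    ∫ ω, payoffAgainst (u i) a (φ (summary lam (fun j => g (j, ω)))) ∂P
      < ∫ ω, payoffAgainst (u i) b (φ (summary lam (fun j => g (j, ω)))) ∂P →
    actionLaw P g i a ≤ ε

/-- Robust perfect equilibrium (in mixed strategies). -/
def IsRobustPerfect (F : FubiniExtension lam P) (u : I → Payoff A) (g : I × Ω → A) : Prop :=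
  IsStrategyProfile F g ∧
  ∃ (gs : ℕ → I × Ω → A) (ε : ℕ → ℝ) (J : ℕ → Set I)
    (φ : ℕ → Dist A → ProbabilityMeasure (Dist A)),
    (∀ n, 0 < ε n) ∧
    (∀ n, IsEpsRobustPerfectWith F u (gs n) (ε n) (J n) (φ n)) ∧
    Tendsto ε atTop (𝓝 0) ∧
    (∀ᵐ i ∂lam, ∃ k : ℕ → ℕ, StrictMono k ∧ (∀ t, i ∈ J (k t)) ∧
      Tendsto (fun t => actionLaw P (gs (k t)) i) atTop (𝓝 (actionLaw P g i))) ∧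
    Tendsto (fun n => ∫ i, actionLaw P (gs n) i ∂lam) atTop (𝓝 (∫ i, actionLaw P g i ∂lam))

/-- Pure strategy robust perfect equilibrium: a pure strategy profile (a measurable map from
players to actions) whose degenerate mixed strategy profile is robust perfect. -/
def IsPureRobustPerfect (F : FubiniExtension lam P) (u : I → Payoff A) (f : I → A) : Prop :=
  Measurable f ∧ IsRobustPerfect F u (fun p => f p.1)

end Profiles

end LargeGame

end

open MeasureTheory ProbabilityTheory Filter Topology

noncomputable section

namespace LargeGame

universe u v w

variable {I : Type u} {Ω : Type v} {A : Type w}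

/-! ### The exact law of large numbers in a Fubini extension. -/

section Fubini

variable [MeasurableSpace I] [MeasurableSpace Ω] {lam : Measure I} {P : Measure Ω}
  {F : FubiniExtension lam P}

/-! By the exact law of large numbers, the summary of a strategy profile is almost surely its
expected action distribution (`exists_summary_eq`). So each perturbed profile `gs n` faces each
player with one deterministic belief `φ n (σs n)`, of full support and with mass at least `1 - ε n`
at `σs n`, where `σs n → σ` and `σ` is the summary of `g`. An action with positive probability under
`g` eventually has probability above `ε` along the player's subsequence, hence is a best reply to
these beliefs (`exists_bestReply`). Full support excludes weakly dominated actions; passing to the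
limit, where the beliefs tend to the Dirac mass at `σ`, gives Nash; redefining `φ n` at the single
point `σ` gives aggregate robustness.

For a realization `f` of `g`, perturbed profiles converging to `f` must keep the aggregates `σs n`,
so that the beliefs do not change. Let `p i` and `q n i` be the action laws of player `i` under `g`
and `gs n`. The kernel `transition` transports `p i` to `q n i`, moving little mass when they are
close; player `i` is assigned its row at the realized action `f i`. Averaging rows over `p i`
returns `q n i` (`sum_mul_transition`), so by the law of large numbers almost every realization has
the right aggregates. Rows converge to the point mass at `f i` (`tendsto_transition`), and entries
are at most `q n i b / p i (f i)` (`transition_le`), so inferior actions remain rare. Richness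
realizes these rows as strategy profiles. -/

/-- The Fubini property only yields integrable sections; completeness upgrades their a.e.
measurability. -/
lemma measurable_of_integrable {X : Type*} [MeasurableSpace X] {μ : Measure X} [μ.IsComplete]
    {f : X → ℝ} (hf : Integrable f μ) : Measurable f :=
  hf.aestronglyMeasurable.aemeasurable.nullMeasurable.measurable_of_complete

namespace FubiniExtension

lemma integrable_of_bound {f : I × Ω → ℝ} (hf : Measurable[F.W] f) {C : ℝ}
    (hC : ∀ p, |f p| ≤ C) : Integrable f F.Q := by
  let _ := F.W
  have := F.isProbabilityMeasure
  exact Integrable.of_bound (measurable_id.comp hf).aestronglyMeasurable C (ae_of_all _ hC)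

lemma measurable_fst : Measurable[F.W] (Prod.fst : I × Ω → I) :=
  fun _ hs => F.prod_le _ (_root_.measurable_fst hs)

lemma measurable_snd : Measurable[F.W] (Prod.snd : I × Ω → Ω) :=
  fun _ hs => F.prod_le _ (_root_.measurable_snd hs)

/-- The exact law of large numbers for bounded essentially pairwise independent processes. -/
theorem ae_integral_eq [IsProbabilityMeasure lam] [IsProbabilityMeasure P] [lam.IsComplete]
    [P.IsComplete] {f : I × Ω → ℝ} (hf : Measurable[F.W] f) {C : ℝ}
    (hC : ∀ p, |f p| ≤ C) (hind : EssPairwiseIndep lam P f) :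
    ∀ᵐ ω ∂P, ∫ i, f (i, ω) ∂lam = ∫ i, ∫ ω', f (i, ω') ∂P ∂lam := by
  have hfi := integrable_of_bound hf hC
  have hC0 : 0 ≤ C := by
    obtain ⟨i⟩ := nonempty_of_isProbabilityMeasure lam
    obtain ⟨ω⟩ := nonempty_of_isProbabilityMeasure P
    exact (abs_nonneg _).trans (hC (i, ω))
  set m : I → ℝ := fun i => ∫ ω, f (i, ω) ∂P with hm
  set H : Ω → ℝ := fun ω => ∫ i, f (i, ω) ∂lam with hH
  set c : ℝ := ∫ i, m i ∂lam with hc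
  have hHi : Integrable H P := F.integrable_integral_right f hfi
  have hHm : Measurable H := measurable_of_integrable hHi
  have hHb : ∀ ω, |H ω| ≤ C := fun ω => by
    have := norm_integral_le_of_norm_le_const (μ := lam) (f := fun i => f (i, ω)) (C := C)
      (ae_of_all _ fun i => hC (i, ω))
    simpa using this
  have hHc : ∫ ω, H ω ∂P = c := by
    rw [hc, ← F.integral_eq_left f hfi, F.integral_eq_right f hfi]
  -- Freezing `j` and exchanging integrals reduces this to pairwise independence. Integrating over
  -- `j` then gives `E[H²] = c²`; as `E[H] = c`, the variance of `H` vanishes.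
  have key : ∀ᵐ j ∂lam, ∫ ω, f (j, ω) * H ω ∂P = m j * c := by
    filter_upwards [hind, F.integrable_left f hfi] with j hj hji
    have hjm : Measurable fun ω => f (j, ω) := measurable_of_integrable hji
    have hprod : Integrable (fun p : I × Ω => f (j, p.2) * f p) F.Q := by
      refine integrable_of_bound (C := C * C) ?_ ?_
      · let _ := F.W
        exact (hjm.comp measurable_snd).mul hf
      · intro p
        rw [abs_mul]
        exact mul_le_mul (hC _) (hC _) (abs_nonneg _) hC0
    calc ∫ ω, f (j, ω) * H ω ∂P = ∫ ω, ∫ i, f (j, ω) * f (i, ω) ∂lam ∂P := by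
          simp only [hH, integral_const_mul]
      _ = ∫ i, ∫ ω, f (j, ω) * f (i, ω) ∂P ∂lam := by
          rw [← F.integral_eq_right _ hprod, F.integral_eq_left _ hprod]
      _ = ∫ i, m j * m i ∂lam := by
          refine integral_congr_ae ?_
          filter_upwards [hj, F.integrable_left f hfi] with i hi hii
          exact hi.integral_fun_mul_eq_mul_integral hji.aestronglyMeasurable
            hii.aestronglyMeasurable
      _ = m j * c := by rw [integral_const_mul]
  have hprod : Integrable (fun p : I × Ω => f p * H p.2) F.Q := by
    refine integrable_of_bound (C := C * C) ?_ ?_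
    · let _ := F.W
      exact hf.mul (hHm.comp measurable_snd)
    · intro p
      rw [abs_mul]
      exact mul_le_mul (hC _) (hHb _) (abs_nonneg _) hC0
  have hsq : ∫ ω, H ω * H ω ∂P = c * c := by
    calc ∫ ω, H ω * H ω ∂P = ∫ ω, ∫ i, f (i, ω) * H ω ∂lam ∂P := by
          simp only [hH, integral_mul_const]
      _ = ∫ i, ∫ ω, f (i, ω) * H ω ∂P ∂lam := by
          rw [← F.integral_eq_right _ hprod, F.integral_eq_left _ hprod]
      _ = ∫ i, m i * c ∂lam := integral_congr_ae key
      _ = c * c := by rw [integral_mul_const]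
  have hHH : Integrable (fun ω => H ω * H ω) P :=
    Integrable.of_bound (hHm.mul hHm).aestronglyMeasurable (C * C) (ae_of_all _ fun ω => by
      rw [Real.norm_eq_abs, abs_mul]
      exact mul_le_mul (hHb _) (hHb _) (abs_nonneg _) hC0)
  have hz : ∫ ω, (H ω - c) ^ 2 ∂P = 0 := by
    have : ∀ ω, (H ω - c) ^ 2 = H ω * H ω - (2 * c * H ω - c * c) := fun ω => by ring
    simp only [this]
    have hi : Integrable (fun ω => 2 * c * H ω - c * c) P :=
      (hHi.const_mul _).sub (integrable_const _)
    rw [integral_sub hHH hi, integral_sub (hHi.const_mul _) (integrable_const _),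
      integral_const_mul, hsq, hHc]
    simp
    ring
  have hint : Integrable (fun ω => (H ω - c) ^ 2) P := by
    have : ∀ ω, (H ω - c) ^ 2 = H ω * H ω - (2 * c * H ω - c * c) := fun ω => by ring
    simp only [this]
    exact hHH.sub ((hHi.const_mul _).sub (integrable_const _))
  have h0 := (integral_eq_zero_iff_of_nonneg (fun ω => sq_nonneg (H ω - c)) hint).1 hz
  filter_upwards [h0] with ω hω
  have : H ω - c = 0 := by simpa using hω
  linarith

end FubiniExtension

end Fubini

lemma actionLaw_nonneg [MeasurableSpace Ω] {P : Measure Ω} (g : I × Ω → A) (i : I) (a : A) :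
    0 ≤ actionLaw P g i a :=
  measureReal_nonneg

lemma measurable_of_indicator {X : Type*} [MeasurableSpace X] [Fintype A] [MeasurableSpace A]
    [DiscreteMeasurableSpace A] {f : X → A}
    (h : ∀ a, Measurable fun x => ({a} : Set A).indicator (fun _ => (1 : ℝ)) (f x)) :
    Measurable f := by
  refine measurable_to_countable' fun a => ?_
  have : f ⁻¹' {a} = (fun x => ({a} : Set A).indicator (fun _ => (1 : ℝ)) (f x)) ⁻¹' {1} := by
    ext x
    by_cases hx : f x = a <;> simp [hx]
  rw [this]
  exact h a (measurableSet_singleton _)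

/-! ### Action laws of strategy profiles. -/

section Profiles

variable [MeasurableSpace I] [MeasurableSpace Ω] {lam : Measure I} {P : Measure Ω}
  [Fintype A] [MeasurableSpace A] [DiscreteMeasurableSpace A] {F : FubiniExtension lam P}

lemma FubiniExtension.measurable_comp_prod {g : I × Ω → A} (hg : Measurable[F.W] g)
    {ψ : I → A → ℝ} (hψ : ∀ a, Measurable fun i => ψ i a) :
    Measurable[F.W] fun p : I × Ω => ψ p.1 (g p) := by
  let _ := F.W
  have h : Measurable fun q : A × I => ψ q.2 q.1 := measurable_from_prod_countable_right hψ
  exact h.comp (hg.prodMk FubiniExtension.measurable_fst)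

lemma indicator_integrable {g : I × Ω → A} (hg : Measurable[F.W] g) (a : A) :
    Integrable (fun p => ({a} : Set A).indicator (fun _ => (1 : ℝ)) (g p)) F.Q :=
  FubiniExtension.integrable_of_bound (C := 1)
    (FubiniExtension.measurable_comp_prod (ψ := fun _ => ({a} : Set A).indicator fun _ => (1 : ℝ))
      hg fun _ => measurable_const) fun p => by
        by_cases h : g p = a <;> simp [h]

lemma ae_measurable_left [P.IsComplete] {g : I × Ω → A} (hg : Measurable[F.W] g) :
    ∀ᵐ i ∂lam, Measurable fun ω => g (i, ω) := by
  have := ae_all_iff.2 fun a => F.integrable_left _ (indicator_integrable hg a)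
  filter_upwards [this] with i hi
  exact measurable_of_indicator fun a => measurable_of_integrable (hi a)

lemma ae_measurable_right [lam.IsComplete] {g : I × Ω → A} (hg : Measurable[F.W] g) :
    ∀ᵐ ω ∂P, Measurable fun i => g (i, ω) := by
  have := ae_all_iff.2 fun a => F.integrable_right _ (indicator_integrable hg a)
  filter_upwards [this] with i hi
  exact measurable_of_indicator fun a => measurable_of_integrable (hi a)

variable [IsProbabilityMeasure P]

lemma integral_comp_eq_sum {ξ : Ω → A} (hξ : Measurable ξ) (v : A → ℝ) :
    ∫ ω, v (ξ ω) ∂P = ∑ a, P.real {ω | ξ ω = a} * v a := by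
  have hmap : IsProbabilityMeasure (P.map ξ) := Measure.isProbabilityMeasure_map hξ.aemeasurable
  rw [← integral_map (f := v) hξ.aemeasurable (by fun_prop), integral_fintype .of_finite]
  refine Finset.sum_congr rfl fun a _ => ?_
  rw [map_measureReal_apply hξ (measurableSet_singleton a), smul_eq_mul]
  rfl

lemma sum_real_fiber {ξ : Ω → A} (hξ : Measurable ξ) : ∑ a, P.real {ω | ξ ω = a} = 1 := by
  have := integral_comp_eq_sum (P := P) hξ fun _ => 1
  simpa using this.symm

lemma ae_sum_actionLaw [P.IsComplete] {g : I × Ω → A} (hg : Measurable[F.W] g) :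
    ∀ᵐ i ∂lam, ∑ a, actionLaw P g i a = 1 := by
  filter_upwards [ae_measurable_left hg] with i hi
  exact sum_real_fiber hi

lemma ae_actionLaw_eq [P.IsComplete] {g : I × Ω → A} (hg : Measurable[F.W] g) (a : A) :
    (fun i => actionLaw P g i a) =ᵐ[lam]
      fun i => ∫ ω, ({a} : Set A).indicator (fun _ => (1 : ℝ)) (g (i, ω)) ∂P := by
  filter_upwards [ae_measurable_left hg] with i hi
  rw [integral_comp_eq_sum hi, Finset.sum_eq_single a]
  · simp [actionLaw]
  · intro b _ hb
    simp [hb]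
  · simp

lemma measurable_actionLaw [P.IsComplete] [lam.IsComplete] {g : I × Ω → A}
    (hg : Measurable[F.W] g) (a : A) : Measurable fun i => actionLaw P g i a :=
  measurable_of_integrable
    ((F.integrable_integral_left _ (indicator_integrable hg a)).congr (ae_actionLaw_eq hg a).symm)

lemma integrable_actionLaw [P.IsComplete] {g : I × Ω → A}
    (hg : Measurable[F.W] g) (a : A) : Integrable (fun i => actionLaw P g i a) lam :=
  (F.integrable_integral_left _ (indicator_integrable hg a)).congr (ae_actionLaw_eq hg a).symm

variable [IsProbabilityMeasure lam] [P.IsComplete] [lam.IsComplete]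

/-- The exact law of large numbers for functionals of a strategy profile. -/
theorem IsStrategyProfile.ae_integral_eq {g : I × Ω → A} (hg : IsStrategyProfile F g)
    {ψ : I → A → ℝ} (hψ : ∀ a, Measurable fun i => ψ i a) {C : ℝ} (hC : ∀ i a, |ψ i a| ≤ C) :
    ∀ᵐ ω ∂P, ∫ i, ψ i (g (i, ω)) ∂lam = ∫ i, ∑ a, actionLaw P g i a * ψ i a ∂lam := by
  have h := FubiniExtension.ae_integral_eq (F := F)
    (FubiniExtension.measurable_comp_prod hg.1 hψ) (C := C) (fun p => hC _ _) (by
      filter_upwards [hg.2] with i hi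
      filter_upwards [hi] with j hj
      exact hj.comp (measurable_of_finite (ψ i)) (measurable_of_finite (ψ j)))
  filter_upwards [h] with ω hω
  rw [hω]
  refine integral_congr_ae ?_
  filter_upwards [ae_measurable_left hg.1] with i hi
  exact integral_comp_eq_sum hi (ψ i)

end Profiles

/-! ### Beliefs concentrated near a point, and best replies. -/

section Payoffs

variable [Fintype A]

/-- The difference `f - f τ` vanishes at `τ`, is at most `2 * C` elsewhere, and the complement of
`{τ}` has mass at most `ε`. -/
lemma abs_integral_sub_le_of_weight {ν : ProbabilityMeasure (Dist A)} {τ : Dist A} {ε C : ℝ}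
    (hν : 1 - ε ≤ (ν : Measure (Dist A)).real {τ}) {f : Dist A → ℝ} (hf : Continuous f)
    (hC : ∀ x, |f x| ≤ C) :
    |∫ x, f x ∂(ν : Measure (Dist A)) - f τ| ≤ 2 * C * ε := by
  have hC0 : 0 ≤ C := (abs_nonneg _).trans (hC τ)
  have hfi : Integrable f (ν : Measure (Dist A)) :=
    Integrable.of_bound hf.measurable.aestronglyMeasurable C (ae_of_all _ hC)
  have hi : Integrable (fun x => f x - f τ) (ν : Measure (Dist A)) := hfi.sub (integrable_const _)
  have h1 : ∫ x, f x ∂(ν : Measure (Dist A)) - f τ = ∫ x, (f x - f τ) ∂(ν : Measure (Dist A)) := by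
    rw [integral_sub hfi (integrable_const _)]
    simp
  have h2 : ∫ x in {τ}, (f x - f τ) ∂(ν : Measure (Dist A)) = 0 :=
    setIntegral_eq_zero_of_forall_eq_zero fun x hx => by
      rw [Set.mem_singleton_iff.1 hx, sub_self]
  rw [h1, ← integral_add_compl (measurableSet_singleton τ) hi, h2, zero_add]
  have h3 : ‖∫ x in {τ}ᶜ, (f x - f τ) ∂(ν : Measure (Dist A))‖
      ≤ 2 * C * (ν : Measure (Dist A)).real {τ}ᶜ :=
    norm_setIntegral_le_of_norm_le_const (measure_lt_top _ _) fun x _ => by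
      have := norm_sub_le (f x) (f τ)
      have h4 := hC x
      have h5 := hC τ
      simp only [Real.norm_eq_abs] at *
      linarith
  have h4 : (ν : Measure (Dist A)).real {τ}ᶜ ≤ ε := by
    rw [probReal_compl_eq_one_sub (measurableSet_singleton τ)]
    linarith
  rw [Real.norm_eq_abs] at h3
  exact h3.trans (mul_le_mul_of_nonneg_left h4 (by positivity))

lemma tendsto_integral_of_weight {νs : ℕ → ProbabilityMeasure (Dist A)} {τs : ℕ → Dist A}
    {τ : Dist A} {ε : ℕ → ℝ} (hν : ∀ n, 1 - ε n ≤ (νs n : Measure (Dist A)).real {τs n})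
    (hε : Tendsto ε atTop (𝓝 0)) (hτ : Tendsto τs atTop (𝓝 τ)) {f : Dist A → ℝ}
    (hf : Continuous f) :
    Tendsto (fun n => ∫ x, f x ∂(νs n : Measure (Dist A))) atTop (𝓝 (f τ)) := by
  obtain ⟨C, hC⟩ := isCompact_univ.exists_bound_of_continuousOn hf.continuousOn
  have h1 : Tendsto (fun n => ∫ x, f x ∂(νs n : Measure (Dist A)) - f (τs n)) atTop (𝓝 0) := by
    refine squeeze_zero_norm (a := fun n => 2 * C * ε n) (fun n => ?_) ?_
    · exact abs_integral_sub_le_of_weight (hν n) hf fun x => hC x trivial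
    · simpa using hε.const_mul (2 * C)
  simpa using h1.add ((hf.tendsto τ).comp hτ)

lemma tendsto_diracProba_of_weight {νs : ℕ → ProbabilityMeasure (Dist A)} {τs : ℕ → Dist A}
    {τ : Dist A} {ε : ℕ → ℝ} (hν : ∀ n, 1 - ε n ≤ (νs n : Measure (Dist A)).real {τs n})
    (hε : Tendsto ε atTop (𝓝 0)) (hτ : Tendsto τs atTop (𝓝 τ)) :
    Tendsto νs atTop (𝓝 (diracProba τ)) := by
  rw [ProbabilityMeasure.tendsto_iff_forall_integral_tendsto]
  intro f
  have := tendsto_integral_of_weight hν hε hτ f.continuous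
  simpa [diracProba] using this

lemma integral_le_integral_of_isMax [MeasurableSpace Ω] {P : Measure Ω}
    [IsProbabilityMeasure P] [MeasurableSpace A] [DiscreteMeasurableSpace A] {v : A → ℝ}
    {ξ ζ : Ω → A} (hξ : Measurable ξ) (hζ : Measurable ζ)
    (h : ∀ a, 0 < P.real {ω | ζ ω = a} → ∀ b, v b ≤ v a) :
    ∫ ω, v (ξ ω) ∂P ≤ ∫ ω, v (ζ ω) ∂P := by
  have hi : ∀ {χ : Ω → A}, Measurable χ → Integrable (fun ω => v (χ ω)) P := fun hχ =>
    (Integrable.of_finite (μ := P.map _) (f := v)).comp_measurable hχ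
  refine integral_mono_ae (hi hξ) (hi hζ) ?_
  have hz : ∀ᵐ ω ∂P, ∀ a, ζ ω = a → 0 < P.real {ω | ζ ω = a} := by
    refine ae_all_iff.2 fun a => ?_
    by_cases ha : P.real {ω | ζ ω = a} = 0
    · have : P {ω | ζ ω = a} = 0 := (measureReal_eq_zero_iff (measure_ne_top _ _)).1 ha
      have h' : ∀ᵐ ω ∂P, ¬ ζ ω = a := by simpa [ae_iff] using this
      filter_upwards [h'] with ω h1 h2 using absurd h2 h1
    · exact ae_of_all _ fun ω _ => lt_of_le_of_ne measureReal_nonneg (Ne.symm ha)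
  filter_upwards [hz] with ω hω
  exact h _ (hω _ rfl) _

open Classical in
-- Perturbation functions need only be Borel, not continuous, so one value may be changed freely.
lemma IsPerturbation.update {φ : Dist A → ProbabilityMeasure (Dist A)} (hφ : IsPerturbation φ)
    (σ : Dist A) {ν : ProbabilityMeasure (Dist A)} (hν : (ν : Measure (Dist A)).IsOpenPosMeasure) :
    IsPerturbation (Function.update φ σ ν) := by
  constructor
  · let _ : MeasurableSpace (ProbabilityMeasure (Dist A)) := borel _
    have h : Function.update φ σ ν = fun τ => if τ ∈ ({σ} : Set (Dist A)) then ν else φ τ := by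
      ext1 τ
      by_cases h : τ = σ
      · subst h; simp
      · simp [h]
    rw [h]
    exact Measurable.ite (measurableSet_singleton σ) measurable_const hφ.1
  · intro τ
    by_cases h : τ = σ
    · subst h
      simpa using hν
    · simpa [h] using hφ.2 τ

variable [TopologicalSpace A]

lemma continuous_payoff (u : Payoff A) (a : A) : Continuous fun τ => u (a, τ) :=
  u.continuous.comp (by fun_prop)

lemma integrable_payoff (u : Payoff A) (a : A) (ν : ProbabilityMeasure (Dist A)) :
    Integrable (fun τ => u (a, τ)) (ν : Measure (Dist A)) := by
  obtain ⟨C, hC⟩ := isCompact_univ.exists_bound_of_continuousOn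
    (continuous_payoff u a).continuousOn
  exact Integrable.of_bound (continuous_payoff u a).measurable.aestronglyMeasurable C
    (ae_of_all _ fun x => hC x trivial)

/-- A weakly dominated action is not a best reply to a belief of full support. -/
lemma exists_payoffAgainst_lt_of_weaklyDominated [MeasurableSpace Ω]
    {P : Measure Ω} [IsProbabilityMeasure P] [MeasurableSpace A] [DiscreteMeasurableSpace A]
    {u : Payoff A} {a : A} (h : WeaklyDominated P u a) (ν : ProbabilityMeasure (Dist A))
    [(ν : Measure (Dist A)).IsOpenPosMeasure] :
    ∃ b, payoffAgainst u a ν < payoffAgainst u b ν := by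
  obtain ⟨ξ, hξ, hle, τ, hlt⟩ := h
  by_contra! hmax
  have hsum : ∀ τ, ∫ ω, u (ξ ω, τ) ∂P = ∑ b, P.real {ω | ξ ω = b} * u (b, τ) := fun τ =>
    integral_comp_eq_sum hξ fun b => u (b, τ)
  simp only [hsum] at hle hlt
  set q : A → ℝ := fun b => P.real {ω | ξ ω = b} with hq
  set d : Dist A → ℝ := fun τ => ∑ b, q b * u (b, τ) - u (a, τ) with hd
  have hdc : Continuous d :=
    (continuous_finsetSum _ fun b _ => continuous_const.mul (continuous_payoff u b)).sub
      (continuous_payoff u a)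
  -- The gain `d` is continuous and strictly positive somewhere, hence on an open set, which `ν`
  -- charges.
  have hpos : 0 < ∫ x, d x ∂(ν : Measure (Dist A)) :=
    hdc.integral_pos_of_hasCompactSupport_nonneg_nonzero (.of_compactSpace d)
      (fun x => sub_nonneg.2 (hle x)) (sub_pos.2 hlt).ne'
  have heq : ∫ x, d x ∂(ν : Measure (Dist A))
      = ∑ b, q b * payoffAgainst u b ν - payoffAgainst u a ν := by
    rw [integral_sub (integrable_finsetSum _ fun b _ => (integrable_payoff u b ν).const_mul _)
      (integrable_payoff u a ν), integral_finsetSum _ fun b _ =>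
        (integrable_payoff u b ν).const_mul _]
    simp only [integral_const_mul]
    rfl
  have hmix : ∑ b, q b * payoffAgainst u b ν ≤ ∑ b, q b * payoffAgainst u a ν :=
    Finset.sum_le_sum fun b _ => mul_le_mul_of_nonneg_left (hmax b) measureReal_nonneg
  rw [← Finset.sum_mul, hq, sum_real_fiber hξ, one_mul] at hmix
  linarith

end Payoffs

lemma coe_summary [MeasurableSpace I] {lam : Measure I}
    [IsProbabilityMeasure lam] [Fintype A] [Nonempty A] [MeasurableSpace A]
    [DiscreteMeasurableSpace A] {f : I → A} (hf : Measurable f) (a : A) :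
    summary lam f a = lam.real {i | f i = a} := by
  rw [summary, dif_pos hf]
  rfl

lemma integral_actionLaw_apply
    [MeasurableSpace I] [MeasurableSpace Ω] {lam : Measure I} {P : Measure Ω}
    [IsProbabilityMeasure P] [P.IsComplete] [Fintype A] [MeasurableSpace A]
    [DiscreteMeasurableSpace A] {F : FubiniExtension lam P} {g : I × Ω → A}
    (hg : Measurable[F.W] g) (a : A) :
    (∫ i, actionLaw P g i ∂lam) a = ∫ i, actionLaw P g i a ∂lam :=
  eval_integral (fun a => integrable_actionLaw hg a) a

/-! ### Admissibility, Nash property and aggregate robustness. -/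

section Refinements

variable [MeasurableSpace I] [MeasurableSpace Ω] {lam : Measure I} {P : Measure Ω}
  [IsProbabilityMeasure lam] [lam.IsComplete] [IsProbabilityMeasure P] [P.IsComplete]
  [Fintype A] [Nonempty A] [MeasurableSpace A] [DiscreteMeasurableSpace A]
  {F : FubiniExtension lam P}

/-- The societal summary of a strategy profile is almost surely its expected action
distribution. -/
theorem IsStrategyProfile.exists_summary_eq {g : I × Ω → A} (hg : IsStrategyProfile F g) :
    ∃ σ : Dist A, σ.1 = ∫ i, actionLaw P g i ∂lam ∧
      ∀ᵐ ω ∂P, summary lam (fun i => g (i, ω)) = σ := by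
  classical
  have h : ∀ᵐ ω ∂P, ∀ a, lam.real {i | g (i, ω) = a} = ∫ i, actionLaw P g i a ∂lam := by
    refine ae_all_iff.2 fun a => ?_
    have := hg.ae_integral_eq (ψ := fun _ => ({a} : Set A).indicator fun _ => (1 : ℝ))
      (fun _ => measurable_const) (C := 1) fun i b => by by_cases h : b = a <;> simp [h]
    filter_upwards [this, ae_measurable_right hg.1] with ω hω hm
    have h1 : ∀ i, ∑ b, actionLaw P g i b * ({a} : Set A).indicator (fun _ => (1 : ℝ)) b
        = actionLaw P g i a := fun i => by
      rw [Finset.sum_eq_single a (fun b _ hb => by simp [hb]) (by simp)]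
      simp
    simp only [h1] at hω
    rw [← hω, integral_comp_eq_sum (P := lam) hm, Finset.sum_eq_single a
      (fun b _ hb => by simp [hb]) (by simp)]
    simp
  have h' : ∀ᵐ ω ∂P, (summary lam (fun i => g (i, ω))).1 = ∫ i, actionLaw P g i ∂lam := by
    filter_upwards [h, ae_measurable_right hg.1] with ω hω hm
    ext a
    rw [integral_actionLaw_apply hg.1, ← hω a]
    exact coe_summary hm a
  -- A realized summary serves as `σ`, so membership in the simplex comes for free.
  obtain ⟨ω₀, hω₀⟩ := h'.exists
  refine ⟨summary lam (fun i => g (i, ω₀)), hω₀, ?_⟩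
  filter_upwards [h'] with ω hω
  exact Subtype.ext (hω.trans hω₀.symm)

variable [TopologicalSpace A] {u : I → Payoff A} {g : I × Ω → A}

/-- Along a subsequence, the actions played under a robust perfect equilibrium are best replies
to the perturbed societal summaries. -/
theorem IsRobustPerfect.exists_bestReply (hg : IsRobustPerfect F u g) :
    ∃ (σs : ℕ → Dist A) (σ : Dist A) (ε : ℕ → ℝ) (φ : ℕ → Dist A → ProbabilityMeasure (Dist A)),
      (∀ n, IsPerturbation (φ n)) ∧
      (∀ n τ, 1 - ε n ≤ (φ n τ : Measure (Dist A)).real {τ}) ∧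
      Tendsto ε atTop (𝓝 0) ∧ Tendsto σs atTop (𝓝 σ) ∧
      (∀ᵐ ω ∂P, summary lam (fun i => g (i, ω)) = σ) ∧
      ∀ᵐ i ∂lam, ∃ k : ℕ → ℕ, StrictMono k ∧ ∀ t a, 0 < actionLaw P g i a → ∀ b,
        payoffAgainst (u i) b (φ (k t) (σs (k t))) ≤
          payoffAgainst (u i) a (φ (k t) (σs (k t))) := by
  obtain ⟨hgs, gs, ε, J, φ, -, hE, hε, hJ, hlim⟩ := hg
  choose σs hσs hsum using fun n => (hE n).isStrategyProfile.exists_summary_eq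
  obtain ⟨σ, hσ, hgsum⟩ := hgs.exists_summary_eq
  refine ⟨σs, σ, ε, φ, fun n => (hE n).isPerturbation, fun n => (hE n).weight, hε, ?_, hgsum, ?_⟩
  · rw [tendsto_subtype_rng, hσ]
    simpa only [hσs] using hlim
  filter_upwards [hJ] with i hi
  obtain ⟨k, hk, hkJ, hkl⟩ := hi
  -- The probabilities tend to a positive limit while `ε` tends to zero; the contrapositive of
  -- rationality then applies.
  have hev : ∀ᶠ t in atTop, ∀ a, 0 < actionLaw P g i a →
      ε (k t) < actionLaw P (gs (k t)) i a := by
    refine eventually_all.2 fun a => ?_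
    by_cases ha : 0 < actionLaw P g i a
    · filter_upwards [(hε.comp hk.tendsto_atTop).eventually_lt ((tendsto_pi_nhds.1 hkl) a) ha]
        with t ht _ using ht
    · exact Eventually.of_forall fun t h => absurd h ha
  obtain ⟨N, hN⟩ := eventually_atTop.1 hev
  refine ⟨fun t => k (t + N), hk.comp (strictMono_id.add_const N), fun t a ha b => ?_⟩
  by_contra! hlt
  refine (hN (t + N) (by omega) a ha).not_ge
    ((hE (k (t + N))).rational i (hkJ _) a b ?_)
  have h : ∀ c, ∫ ω, payoffAgainst (u i) c
      (φ (k (t + N)) (summary lam fun j => gs (k (t + N)) (j, ω))) ∂P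
      = payoffAgainst (u i) c (φ (k (t + N)) (σs (k (t + N)))) := fun c => by
    rw [integral_congr_ae (g := fun _ => payoffAgainst (u i) c (φ (k (t + N)) (σs (k (t + N)))))]
    · simp
    · filter_upwards [hsum (k (t + N))] with ω hω
      rw [hω]
  rw [h, h]
  exact hlt

theorem IsRobustPerfect.isAdmissible (hg : IsRobustPerfect F u g) : IsAdmissible F u g := by
  obtain ⟨σs, σ, ε, φ, hφ, -, -, -, -, hbr⟩ := hg.exists_bestReply
  refine ⟨hg.1, ?_⟩
  filter_upwards [hbr] with i hi a ha
  obtain ⟨k, -, hk⟩ := hi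
  by_contra h
  have := (hφ (k 0)).2 (σs (k 0))
  obtain ⟨b, hb⟩ := exists_payoffAgainst_lt_of_weaklyDominated ha (φ (k 0) (σs (k 0)))
  exact hb.not_ge (hk 0 a (lt_of_le_of_ne (actionLaw_nonneg g i a) (Ne.symm h)) b)

theorem IsRobustPerfect.isNash (hg : IsRobustPerfect F u g) : IsNash F u g := by
  obtain ⟨σs, σ, ε, φ, hφ, hw, hε, hσ, hsum, hbr⟩ := hg.exists_bestReply
  refine ⟨hg.1, ?_⟩
  filter_upwards [hbr, ae_measurable_left hg.1.1] with i hi hm ξ hξ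
  obtain ⟨k, hk, hbest⟩ := hi
  have h : ∀ ζ : Ω → A, ∫ ω, u i (ζ ω, summary lam (fun j => g (j, ω))) ∂P
      = ∫ ω, u i (ζ ω, σ) ∂P := fun ζ => by
    refine integral_congr_ae ?_
    filter_upwards [hsum] with ω hω
    rw [hω]
  rw [h ξ, h fun ω => g (i, ω)]
  refine integral_le_integral_of_isMax (v := fun a => u i (a, σ)) hξ hm fun a ha b => ?_
  have hl : ∀ c, Tendsto (fun t => payoffAgainst (u i) c (φ (k t) (σs (k t)))) atTop
      (𝓝 (u i (c, σ))) := fun c =>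
    tendsto_integral_of_weight (fun t => hw (k t) (σs (k t))) (hε.comp hk.tendsto_atTop)
      (hσ.comp hk.tendsto_atTop) (continuous_payoff (u i) c)
  exact le_of_tendsto_of_tendsto' (hl b) (hl a) fun t => hbest t a ha b

/-- The best-reply property is known at `σs (k t)`, while the definition tests at `σ`. Transplanting
the value of `φ (k t)` to `σ` repairs this, and convergence at `σ` survives since `σs (k t) → σ`. -/
theorem IsRobustPerfect.isAggregateRobust (hg : IsRobustPerfect F u g) :
    IsAggregateRobust F u g := by
  classical
  obtain ⟨σs, σ, ε, φ, hφ, hw, hε, hσ, hsum, hbr⟩ := hg.exists_bestReply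
  refine ⟨hg.1, ?_⟩
  filter_upwards [hbr, ae_measurable_left hg.1.1] with i hi hm
  obtain ⟨k, hk, hbest⟩ := hi
  refine ⟨fun t => Function.update (φ (k t)) σ (φ (k t) (σs (k t))),
    fun t => (hφ (k t)).update σ ((hφ (k t)).2 _), fun τ => ?_, fun t ξ hξ => ?_⟩
  · by_cases h : τ = σ
    · subst h
      simpa using tendsto_diracProba_of_weight (fun t => hw (k t) (σs (k t)))
        (hε.comp hk.tendsto_atTop) (hσ.comp hk.tendsto_atTop)
    · simpa [h] using tendsto_diracProba_of_weight (fun t => hw (k t) τ)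
        (hε.comp hk.tendsto_atTop) tendsto_const_nhds
  · have h : ∀ ζ : Ω → A, ∫ ω, payoffAgainst (u i) (ζ ω)
        (Function.update (φ (k t)) σ (φ (k t) (σs (k t))) (summary lam fun j => g (j, ω))) ∂P
        = ∫ ω, payoffAgainst (u i) (ζ ω) (φ (k t) (σs (k t))) ∂P := fun ζ => by
      refine integral_congr_ae ?_
      filter_upwards [hsum] with ω hω
      rw [hω, Function.update_self]
    rw [h ξ, h fun ω => g (i, ω)]
    exact integral_le_integral_of_isMax
      (v := fun a => payoffAgainst (u i) a (φ (k t) (σs (k t)))) hξ hm fun a ha b =>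
        hbest t a ha b

end Refinements

/-! ### Transporting one mixed action to a nearby one. -/

section Coupling

variable [Fintype A]

/-- The maximal coupling of two probability vectors. -/
def coupling [DecidableEq A] (p q : A → ℝ) (a b : A) : ℝ :=
  (if a = b then min (p a) (q a) else 0) +
    (p a - min (p a) (q a)) * (q b - min (p b) (q b)) / (1 - ∑ x, min (p x) (q x))

/-- A transition kernel transporting `p` to `q` that moves little mass if `c` is small and `q` is
close to `p`. -/
def transition [DecidableEq A] (c : ℝ) (p q : A → ℝ) (a b : A) : ℝ :=
  if p a = 0 then q b else (1 - c) * (coupling p q a b / p a) + c * q b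

lemma sum_min_le_one {p q : A → ℝ} (hp : p ∈ stdSimplex ℝ A) : ∑ x, min (p x) (q x) ≤ 1 :=
  hp.2 ▸ Finset.sum_le_sum fun _ _ => min_le_left _ _

variable [DecidableEq A] {p q : A → ℝ} (hp : p ∈ stdSimplex ℝ A) (hq : q ∈ stdSimplex ℝ A)
  {c : ℝ}

include hp hq

lemma coupling_nonneg (a b : A) : 0 ≤ coupling p q a b := by
  refine add_nonneg ?_ (div_nonneg (mul_nonneg ?_ ?_) ?_)
  · split_ifs
    · exact le_min (hp.1 a) (hq.1 a)
    · exact le_rfl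
  · exact sub_nonneg.2 (min_le_left _ _)
  · exact sub_nonneg.2 (min_le_right _ _)
  · exact sub_nonneg.2 (sum_min_le_one hp)

lemma sum_coupling_left (b : A) : ∑ a, coupling p q a b = q b := by
  have h1 : ∑ a, (p a - min (p a) (q a)) = 1 - ∑ x, min (p x) (q x) := by
    rw [Finset.sum_sub_distrib, hp.2]
  have h2 : ∑ a, (q a - min (p a) (q a)) = 1 - ∑ x, min (p x) (q x) := by
    rw [Finset.sum_sub_distrib, hq.2]
  unfold coupling
  rw [Finset.sum_add_distrib, ← Finset.sum_div, ← Finset.sum_mul, h1, Finset.sum_ite_eq']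
  simp only [Finset.mem_univ, if_true]
  -- In the degenerate case `p = q`: the residuals vanish and division by zero returns the correct
  -- value `0`.
  by_cases hd : 1 - ∑ x, min (p x) (q x) = 0
  · have := (Finset.sum_eq_zero_iff_of_nonneg fun x _ =>
      sub_nonneg.2 (min_le_right (p x) (q x))).1 (h2.trans hd) b (Finset.mem_univ b)
    rw [hd]
    simp only [zero_mul, zero_div]
    linarith
  · field_simp
    ring

lemma sum_coupling_right (a : A) : ∑ b, coupling p q a b = p a := by
  have h1 : ∑ a, (p a - min (p a) (q a)) = 1 - ∑ x, min (p x) (q x) := by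
    rw [Finset.sum_sub_distrib, hp.2]
  have h2 : ∑ a, (q a - min (p a) (q a)) = 1 - ∑ x, min (p x) (q x) := by
    rw [Finset.sum_sub_distrib, hq.2]
  unfold coupling
  rw [Finset.sum_add_distrib, ← Finset.sum_div, ← Finset.mul_sum, h2, Finset.sum_ite_eq]
  simp only [Finset.mem_univ, if_true]
  by_cases hd : 1 - ∑ x, min (p x) (q x) = 0
  · have := (Finset.sum_eq_zero_iff_of_nonneg fun x _ =>
      sub_nonneg.2 (min_le_left (p x) (q x))).1 (h1.trans hd) a (Finset.mem_univ a)
    rw [hd]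
    simp only [mul_zero, zero_div]
    linarith
  · field_simp
    ring

lemma transition_mem_stdSimplex (hc0 : 0 ≤ c) (hc1 : c ≤ 1) (a : A) :
    transition c p q a ∈ stdSimplex ℝ A := by
  by_cases ha : p a = 0
  · have : transition c p q a = q := by
      ext b
      simp [transition, ha]
    rwa [this]
  · refine ⟨fun b => ?_, ?_⟩
    · rw [transition, if_neg ha]
      exact add_nonneg (mul_nonneg (sub_nonneg.2 hc1)
        (div_nonneg (coupling_nonneg hp hq a b) (hp.1 a))) (mul_nonneg hc0 (hq.1 b))
    · simp only [transition, if_neg ha]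
      rw [Finset.sum_add_distrib, ← Finset.mul_sum, ← Finset.mul_sum, ← Finset.sum_div,
        sum_coupling_right hp hq, hq.2, div_self ha]
      ring

lemma sum_mul_transition (b : A) : ∑ a, p a * transition c p q a b = q b := by
  have h : ∀ a, p a * transition c p q a b = (1 - c) * coupling p q a b + c * (p a * q b) := by
    intro a
    by_cases ha : p a = 0
    -- A null row of `p` carries no coupling mass, so the arbitrary choice `q b` there is harmless.
    · have h0 := (Finset.sum_eq_zero_iff_of_nonneg fun x _ =>
        coupling_nonneg hp hq a x).1 ((sum_coupling_right hp hq a).trans ha) b (Finset.mem_univ b)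
      simp [ha, h0]
    · rw [transition, if_neg ha]
      field_simp
  simp only [h]
  rw [Finset.sum_add_distrib, ← Finset.mul_sum, ← Finset.mul_sum, ← Finset.sum_mul,
    sum_coupling_left hp hq, hp.2]
  ring

/-- The admixture `c * q b` exists for this: the coupling alone may have zero entries. -/
lemma transition_pos (hc0 : 0 < c) (hc1 : c ≤ 1) (a b : A) (hb : 0 < q b) :
    0 < transition c p q a b := by
  by_cases ha : p a = 0
  · rwa [transition, if_pos ha]
  · rw [transition, if_neg ha]
    exact add_pos_of_nonneg_of_pos (mul_nonneg (sub_nonneg.2 hc1)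
      (div_nonneg (coupling_nonneg hp hq a b) (hp.1 a))) (mul_pos hc0 hb)

lemma transition_le (hc0 : 0 ≤ c) (hc1 : c ≤ 1) {a : A} (ha : 0 < p a) (b : A) :
    transition c p q a b ≤ q b / p a := by
  have h1 := Finset.single_le_sum (f := fun a => p a * transition c p q a b)
    (fun x _ => mul_nonneg (hp.1 x) ((transition_mem_stdSimplex hp hq hc0 hc1 x).1 b))
    (Finset.mem_univ a)
  rw [sum_mul_transition hp hq b] at h1
  rw [le_div_iff₀ ha]
  linarith

lemma le_transition_self (hc0 : 0 ≤ c) (hc1 : c ≤ 1) {a : A} (ha : 0 < p a) :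
    (1 - c) * (min (p a) (q a) / p a) ≤ transition c p q a a := by
  rw [transition, if_neg ha.ne']
  have h : min (p a) (q a) ≤ coupling p q a a := by
    rw [coupling, if_pos rfl]
    exact le_add_of_nonneg_right (div_nonneg (mul_nonneg (sub_nonneg.2 (min_le_left _ _))
      (sub_nonneg.2 (min_le_right _ _))) (sub_nonneg.2 (sum_min_le_one hp)))
  have := mul_nonneg hc0 (hq.1 a)
  have h2 := mul_le_mul_of_nonneg_left (div_le_div_of_nonneg_right h ha.le) (sub_nonneg.2 hc1)
  linarith

omit hq in
-- The diagonal entry is squeezed between `(1 - c) * min (p a) (q a) / p a` and `1`; the row sum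
-- forces the other entries to zero.
lemma tendsto_transition {qs : ℕ → A → ℝ} (hqs : ∀ n, qs n ∈ stdSimplex ℝ A)
    (hlim : Tendsto qs atTop (𝓝 p)) {cs : ℕ → ℝ} (hc0 : ∀ n, 0 ≤ cs n) (hc1 : ∀ n, cs n ≤ 1)
    (hcs : Tendsto cs atTop (𝓝 0)) {a : A} (ha : 0 < p a) :
    Tendsto (fun n => transition (cs n) p (qs n) a) atTop (𝓝 (Pi.single a 1)) := by
  have hmem := fun n => transition_mem_stdSimplex hp (hqs n) (hc0 n) (hc1 n) a
  have hle : ∀ n b, transition (cs n) p (qs n) a b ≤ 1 := fun n b =>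
    (hmem n).2 ▸ Finset.single_le_sum (fun x _ => (hmem n).1 x) (Finset.mem_univ b)
  have hself : Tendsto (fun n => transition (cs n) p (qs n) a a) atTop (𝓝 1) := by
    refine tendsto_of_tendsto_of_tendsto_of_le_of_le (?_ : Tendsto
      (fun n => (1 - cs n) * (min (p a) (qs n a) / p a)) atTop (𝓝 1)) tendsto_const_nhds
      (fun n => le_transition_self hp (hqs n) (hc0 n) (hc1 n) ha) fun n => hle n a
    have h := (tendsto_const_nhds (x := (1 : ℝ)).sub hcs).mul
      (((tendsto_const_nhds (x := p a)).min ((tendsto_pi_nhds.1 hlim) a)).div_const (p a))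
    simpa [ha.ne'] using h
  rw [tendsto_pi_nhds]
  intro b
  by_cases hb : b = a
  · subst hb
    simpa using hself
  · rw [Pi.single_eq_of_ne hb]
    refine squeeze_zero (fun n => (hmem n).1 b) (fun n => ?_)
      (by simpa using (tendsto_const_nhds (x := (1 : ℝ))).sub hself)
    have h := Finset.add_le_sum (s := Finset.univ) (f := transition (cs n) p (qs n) a)
      (fun x _ => (hmem n).1 x) (Finset.mem_univ b) (Finset.mem_univ a) hb
    rw [(hmem n).2] at h
    linarith

omit hp hq in
lemma measurable_transition [MeasurableSpace I] {p q : I → A → ℝ}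
    (hp : Measurable p) (hq : Measurable q) (a b : A) :
    Measurable fun i => transition c (p i) (q i) a b := by
  have hp' := measurable_pi_iff.1 hp
  have hq' := measurable_pi_iff.1 hq
  unfold transition coupling
  refine Measurable.ite (measurableSet_eq_fun (hp' a) measurable_const) (hq' b) ?_
  split_ifs <;> fun_prop

end Coupling

/-! ### Realizing prescribed action laws by strategy profiles. -/

section Realization

variable [MeasurableSpace I] [MeasurableSpace Ω] {lam : Measure I} {P : Measure Ω}
  [Fintype A] [Nonempty A] [MeasurableSpace A] [DiscreteMeasurableSpace A]
  {F : FubiniExtension lam P}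

/-- In a rich Fubini extension every measurable assignment of mixed actions is the law of a
strategy profile. -/
theorem FubiniExtension.IsRich.exists_strategyProfile [IsProbabilityMeasure lam]
    (hF : F.IsRich) {x : I → A → ℝ}
    (hx : Measurable x) (hxs : ∀ i, x i ∈ stdSimplex ℝ A) :
    ∃ h : I × Ω → A, IsStrategyProfile F h ∧ ∀ᵐ i ∂lam, actionLaw P h i = x i := by
  obtain ⟨η, hη, hu, hind⟩ := hF
  let _ : TopologicalSpace A := ⊥
  have : DiscreteTopology A := ⟨rfl⟩
  let κ : Kernel I A :=
    { toFun := fun i => ∑ a, ENNReal.ofReal (x i a) • Measure.dirac a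
      measurable' := by
        refine Measure.measurable_of_measurable_coe _ fun s _ => ?_
        simp only [Measure.coe_finsetSum, Finset.sum_apply, Measure.smul_apply, smul_eq_mul]
        exact Finset.measurable_sum _ fun a _ =>
          ((measurable_pi_iff.1 hx a).ennreal_ofReal).mul_const _ }
  have hκ : ∀ i, κ i = ∑ a, ENNReal.ofReal (x i a) • Measure.dirac a := fun i => rfl
  have hκm : IsMarkovKernel κ := ⟨fun i => ⟨by
    rw [hκ]
    simp only [Measure.coe_finsetSum, Finset.sum_apply, Measure.smul_apply, smul_eq_mul,
      measure_univ, mul_one]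
    rw [← ENNReal.ofReal_sum_of_nonneg fun a _ => (hxs i).1 a, (hxs i).2, ENNReal.ofReal_one]⟩⟩
  obtain ⟨G, hG, hGκ⟩ := κ.exists_measurable_map_eq_unitInterval
  have hGi : ∀ i, Measurable (G i) := fun i => hG.comp measurable_prodMk_left
  refine ⟨fun p => G p.1 (η p), ⟨?_, ?_⟩, ?_⟩
  · let _ := F.W
    exact hG.comp (FubiniExtension.measurable_fst.prodMk hη)
  · filter_upwards [hind] with i hi
    filter_upwards [hi] with j hj
    exact hj.comp (hGi i) (hGi j)
  · filter_upwards [hu] with i hi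
    ext a
    have hm : AEMeasurable (fun ω => η (i, ω)) P := by
      by_contra h
      rw [Measure.map_of_not_aemeasurable h] at hi
      exact (NeZero.ne (volume : Measure unitInterval)) hi.symm
    -- `G i` pushes the uniform law to `κ i`, and `η (i, ·)` is uniform.
    have h1 : P {ω | G i (η (i, ω)) = a} = κ i {a} := by
      rw [← hGκ i, Measure.map_apply (hGi i) (measurableSet_singleton a), ← hi,
        Measure.map_apply_of_aemeasurable hm (hGi i (measurableSet_singleton a))]
      rfl
    have h2 : κ i {a} = ENNReal.ofReal (x i a) := by
      classical
      rw [hκ]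
      simp only [Measure.coe_finsetSum, Finset.sum_apply, Measure.smul_apply, smul_eq_mul]
      rw [Finset.sum_eq_single a (fun b _ hb => by simp [hb]) (by simp)]
      simp
    change (P {ω | G i (η (i, ω)) = a}).toReal = x i a
    rw [h1, h2, ENNReal.toReal_ofReal ((hxs i).1 a)]

/-- A measurable version of the action distributions of a strategy profile. -/
lemma exists_measurable_law [lam.IsComplete] [IsProbabilityMeasure P] [P.IsComplete]
    {g : I × Ω → A} (hg : Measurable[F.W] g) :
    ∃ p : I → A → ℝ, Measurable p ∧ (∀ i, p i ∈ stdSimplex ℝ A) ∧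
      ∀ᵐ i ∂lam, actionLaw P g i = p i := by
  classical
  have hm : Measurable (actionLaw P g) := measurable_pi_iff.2 fun a => measurable_actionLaw hg a
  refine ⟨fun i => if actionLaw P g i ∈ stdSimplex ℝ A then actionLaw P g i else
    Pi.single (Classical.arbitrary A) 1, ?_, fun i => ?_, ?_⟩
  · exact Measurable.ite (hm (isClosed_stdSimplex ℝ A).measurableSet) hm measurable_const
  · dsimp only
    split_ifs with h
    · exact h
    · exact single_mem_stdSimplex ℝ _
  · filter_upwards [ae_sum_actionLaw hg] with i hi
    rw [if_pos ⟨actionLaw_nonneg g i, hi⟩]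

end Realization

lemma actionLaw_pure [MeasurableSpace Ω] {P : Measure Ω}
    [IsProbabilityMeasure P] [DecidableEq A] (f : I → A) (i : I) :
    actionLaw P (fun p : I × Ω => f p.1) i = Pi.single (f i) 1 := by
  ext a
  by_cases h : f i = a
  · subst h
    simp [actionLaw]
  · simp [actionLaw, h]

/-- The indicators tend to one almost everywhere. No uniform lower bound on `r` is needed, which
lets a vanishing threshold handle players whose realized action has small probability. -/
lemma tendsto_measureReal_setOf_lt [MeasurableSpace I] {lam : Measure I}
    [IsProbabilityMeasure lam] {θ : ℕ → ℝ} (hθ : Tendsto θ atTop (𝓝 0)) {r : I → ℝ}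
    (hr : Measurable r) {G : Set I} (hG : MeasurableSet G) (hGae : ∀ᵐ i ∂lam, i ∈ G)
    (hpos : ∀ᵐ i ∂lam, 0 < r i) :
    Tendsto (fun n => lam.real ({i | θ n < r i} ∩ G)) atTop (𝓝 1) := by
  have h := tendsto_measure_of_ae_tendsto_indicator_of_isFiniteMeasure (μ := lam)
    (A := Set.univ) (As := fun n => {i | θ n < r i} ∩ G) atTop MeasurableSet.univ
    (fun n => (measurableSet_lt measurable_const hr).inter hG) (by
      filter_upwards [hGae, hpos] with i hi hri
      filter_upwards [hθ.eventually_lt_const hri] with n hn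
      simp [hi, hn])
  rw [measure_univ] at h
  exact (ENNReal.tendsto_toReal ENNReal.one_ne_top).comp h

lemma isStrategyProfile_of_pure [MeasurableSpace I]
    [MeasurableSpace Ω] {lam : Measure I} {P : Measure Ω} [IsProbabilityMeasure P]
    [MeasurableSpace A] {F : FubiniExtension lam P} {f : I → A} (hf : Measurable f) :
    IsStrategyProfile F fun p => f p.1 := by
  refine ⟨?_, ae_of_all _ fun i => ae_of_all _ fun j => indepFun_const_left (f i) _⟩
  let _ := F.W
  exact hf.comp FubiniExtension.measurable_fst

/-! ### Realized profiles are robust perfect. -/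

section Purification

variable [MeasurableSpace I] [MeasurableSpace Ω] {lam : Measure I} {P : Measure Ω}
  [IsProbabilityMeasure lam] [lam.IsComplete] [IsProbabilityMeasure P] [P.IsComplete]
  [Fintype A] [Nonempty A] [TopologicalSpace A] [MeasurableSpace A] [DiscreteMeasurableSpace A]
  {F : FubiniExtension lam P} {u : I → Payoff A}

lemma integral_payoffAgainst_summary {g : I × Ω → A} (hg : IsStrategyProfile F g) {σ : Dist A}
    (hσ : σ.1 = ∫ i, actionLaw P g i ∂lam) (v : Payoff A) (a : A)
    (φ : Dist A → ProbabilityMeasure (Dist A)) :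
    ∫ ω, payoffAgainst v a (φ (summary lam (fun j => g (j, ω)))) ∂P
      = payoffAgainst v a (φ σ) := by
  obtain ⟨σ', hσ', hs⟩ := hg.exists_summary_eq
  have h : σ' = σ := Subtype.ext (hσ'.trans hσ.symm)
  rw [integral_congr_ae (g := fun _ => payoffAgainst v a (φ σ))]
  · simp
  · filter_upwards [hs] with ω hω
    rw [hω, h]

open Classical in
/-- A pure strategy profile that plays actions in the supports of a robust perfect equilibrium,
with the transported perturbed profiles matching the perturbed societal summaries, is robust
perfect. -/
theorem isPureRobustPerfect_of_transition (hF : F.IsRich) {g : I × Ω → A}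
    {gs : ℕ → I × Ω → A} {ε : ℕ → ℝ} {J : ℕ → Set I}
    {φ : ℕ → Dist A → ProbabilityMeasure (Dist A)} (hε0 : ∀ n, 0 < ε n)
    (hE : ∀ n, IsEpsRobustPerfectWith F u (gs n) (ε n) (J n) (φ n))
    (hε : Tendsto ε atTop (𝓝 0))
    (hJ : ∀ᵐ i ∂lam, ∃ k : ℕ → ℕ, StrictMono k ∧ (∀ t, i ∈ J (k t)) ∧
      Tendsto (fun t => actionLaw P (gs (k t)) i) atTop (𝓝 (actionLaw P g i)))
    (hlim : Tendsto (fun n => ∫ i, actionLaw P (gs n) i ∂lam) atTop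
      (𝓝 (∫ i, actionLaw P g i ∂lam)))
    {c : ℕ → ℝ} (hc0 : ∀ n, 0 < c n) (hc1 : ∀ n, c n ≤ 1) (hc : Tendsto c atTop (𝓝 0))
    {p : I → A → ℝ} (hp : Measurable p) (hps : ∀ i, p i ∈ stdSimplex ℝ A)
    (hpg : ∀ᵐ i ∂lam, actionLaw P g i = p i)
    {q : ℕ → I → A → ℝ} (hq : ∀ n, Measurable (q n)) (hqs : ∀ n i, q n i ∈ stdSimplex ℝ A)
    (hqg : ∀ n, ∀ᵐ i ∂lam, actionLaw P (gs n) i = q n i)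
    {f : I → A} (hf : Measurable f) (hpf : ∀ᵐ i ∂lam, 0 < p i (f i))
    (hfs : (summary lam f).1 = ∫ i, actionLaw P g i ∂lam)
    (hT : ∀ n b, ∫ i, transition (c n) (p i) (q n i) (f i) b ∂lam = ∫ i, q n i b ∂lam) :
    IsPureRobustPerfect F u f := by
  have hcomp : ∀ {ψ : I → A → ℝ}, (∀ a, Measurable fun i => ψ i a) →
      Measurable fun i => ψ i (f i) := fun {ψ} hψ =>
    (measurable_from_prod_countable_right (f := fun z : A × I => ψ z.2 z.1) hψ).comp
      (hf.prodMk measurable_id)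
  have hx : ∀ n, Measurable fun i => transition (c n) (p i) (q n i) (f i) := fun n =>
    measurable_pi_iff.2 fun b => hcomp (ψ := fun i a => transition (c n) (p i) (q n i) a b)
      fun a => measurable_transition hp (hq n) a b
  have hxs : ∀ n i, transition (c n) (p i) (q n i) (f i) ∈ stdSimplex ℝ A := fun n i =>
    transition_mem_stdSimplex (hps i) (hqs n i) (hc0 n).le (hc1 n) (f i)
  choose hs hsP hsx using fun n => hF.exists_strategyProfile (hx n) (hxs n)
  choose σs hσs _ using fun n => (hE n).isStrategyProfile.exists_summary_eq
  -- Equal aggregates mean that `hs n` and `gs n` induce the same beliefs, so rationality transfers.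
  have hσh : ∀ n, (σs n).1 = ∫ i, actionLaw P (hs n) i ∂lam := fun n => by
    ext b
    rw [hσs, integral_actionLaw_apply (hE n).isStrategyProfile.1,
      integral_actionLaw_apply (hsP n).1]
    have e1 : ∫ i, actionLaw P (gs n) i b ∂lam = ∫ i, q n i b ∂lam := integral_congr_ae <| by
      filter_upwards [hqg n] with i hi
      rw [hi]
    have e2 : ∫ i, actionLaw P (hs n) i b ∂lam
        = ∫ i, transition (c n) (p i) (q n i) (f i) b ∂lam := integral_congr_ae <| by
      filter_upwards [hsx n] with i hi
      rw [hi]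
    rw [e1, e2, hT]
  set G : Set I := {i | ∀ n, actionLaw P (hs n) i = transition (c n) (p i) (q n i) (f i) ∧
    actionLaw P (gs n) i = q n i} with hGdef
  have hGae : ∀ᵐ i ∂lam, i ∈ G := ae_all_iff.2 fun n => (hsx n).and (hqg n)
  have hG : MeasurableSet G :=
    MeasurableSet.of_compl (Measure.IsComplete.out' _ hGae)
  have hr : Measurable fun i => p i (f i) := hcomp fun a => measurable_pi_iff.1 hp a
  have hsq : Tendsto (fun n => √(ε n)) atTop (𝓝 0) := by
    simpa [Function.comp_def] using (Real.continuous_sqrt.tendsto 0).comp hε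
  -- The threshold `√(ε n)` balances two demands: it tends to zero, and `q n i a ≤ ε n` yields `q n
  -- i a / p i (f i) ≤ √(ε n)`.
  set K : ℕ → Set I := fun n => {i | √(ε n) < p i (f i)} ∩ G with hK
  have hKm : ∀ n, MeasurableSet (K n) := fun n =>
    (measurableSet_lt measurable_const hr).inter hG
  have hKlim : Tendsto (fun n => lam.real (K n)) atTop (𝓝 1) :=
    tendsto_measureReal_setOf_lt hsq hr hG hGae hpf
  have hJK : ∀ n, 1 - lam.real (J n ∩ K n) ≤ ε n + (1 - lam.real (K n)) := fun n => by
    have h1 := measureReal_union_add_inter (μ := lam) (s := J n) (hKm n)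
    have h2 : lam.real (J n ∪ K n) ≤ 1 := measureReal_le_one
    have h3 := (hE n).measure_gt
    linarith
  -- In the new tolerance `ε n` covers the weight condition, `√(ε n)` rationality, and the last term
  -- the measure lost in passing to `J n ∩ K n`.
  refine ⟨hf, isStrategyProfile_of_pure hf, hs,
    fun n => ε n + √(ε n) + (1 - lam.real (J n ∩ K n)), fun n => J n ∩ K n, φ,
    fun n => ?_, fun n => ?_, ?_, ?_, ?_⟩
  · have : lam.real (J n ∩ K n) ≤ 1 := measureReal_le_one
    have := hε0 n
    have := Real.sqrt_nonneg (ε n)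
    linarith
  · have hle1 : lam.real (J n ∩ K n) ≤ 1 := measureReal_le_one
    have h0 := hε0 n
    have hs0 := Real.sqrt_pos.2 h0
    refine ⟨hsP n, ?_, (hE n).measurableSet.inter (hKm n), (hE n).isPerturbation, ?_,
      fun τ => ?_, ?_⟩
    · filter_upwards [(hE n).fullSupport, hGae] with i hi hiG a
      rw [(hiG n).1]
      refine transition_pos (hps i) (hqs n i) (hc0 n) (hc1 n) _ _ ?_
      rw [← (hiG n).2]
      exact hi a
    · linarith
    · have := (hE n).weight τ
      linarith
    · intro i hi a b hab
      rw [integral_payoffAgainst_summary (hsP n) (hσh n),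
        integral_payoffAgainst_summary (hsP n) (hσh n),
        ← integral_payoffAgainst_summary (hE n).isStrategyProfile (hσs n),
        ← integral_payoffAgainst_summary (hE n).isStrategyProfile (hσs n)] at hab
      have hqε := (hE n).rational i hi.1 a b hab
      have hiK : √(ε n) < p i (f i) := hi.2.1
      rw [(hi.2.2 n).2] at hqε
      rw [(hi.2.2 n).1]
      have hpos : 0 < p i (f i) := hs0.trans hiK
      calc transition (c n) (p i) (q n i) (f i) a ≤ q n i a / p i (f i) :=
            transition_le (hps i) (hqs n i) (hc0 n).le (hc1 n) hpos a
        _ ≤ √(ε n) := by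
            rw [div_le_iff₀ hpos]
            calc q n i a ≤ ε n := hqε
              _ = √(ε n) * √(ε n) := (Real.mul_self_sqrt h0.le).symm
              _ ≤ √(ε n) * p i (f i) := mul_le_mul_of_nonneg_left hiK.le hs0.le
        _ ≤ _ := by linarith
  · have h1 : Tendsto (fun n => 1 - lam.real (J n ∩ K n)) atTop (𝓝 0) := by
      refine squeeze_zero (fun n => sub_nonneg.2 measureReal_le_one) hJK ?_
      simpa using hε.add ((tendsto_const_nhds (x := (1 : ℝ))).sub hKlim)
    simpa using (hε.add hsq).add h1
  · filter_upwards [hJ, hpf, hGae, hpg] with i hi hpi hiG hgi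
    obtain ⟨k, hk, hkJ, hkl⟩ := hi
    obtain ⟨N, hN⟩ := eventually_atTop.1
      ((hsq.comp hk.tendsto_atTop).eventually_lt_const hpi)
    refine ⟨fun t => k (t + N), hk.comp (strictMono_id.add_const N),
      fun t => ⟨hkJ _, hN (t + N) (by omega), hiG⟩, ?_⟩
    have h1 : ∀ t, actionLaw P (hs (k (t + N))) i
        = transition (c (k (t + N))) (p i) (q (k (t + N)) i) (f i) := fun t =>
      (hiG (k (t + N))).1
    simp only [h1]
    rw [actionLaw_pure f i]
    have hkN : Tendsto (fun t => k (t + N)) atTop atTop :=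
      hk.tendsto_atTop.comp (tendsto_add_atTop_nat N)
    refine tendsto_transition (qs := fun t => q (k (t + N)) i) (cs := fun t => c (k (t + N)))
      (hps i) (fun t => hqs _ i) ?_ (fun t => (hc0 _).le) (fun t => hc1 _) (hc.comp hkN) hpi
    have h2 := hkl.comp (tendsto_add_atTop_nat N)
    rw [hgi] at h2
    refine h2.congr fun t => (hiG (k (t + N))).2
  · have h1 : ∫ i, actionLaw P (fun p : I × Ω => f p.1) i ∂lam = (summary lam f).1 := by
      have hfp : IsStrategyProfile F fun p : I × Ω => f p.1 := isStrategyProfile_of_pure hf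
      obtain ⟨σ, hσ, hσs⟩ := hfp.exists_summary_eq
      obtain ⟨ω, hω⟩ := hσs.exists
      rw [← hσ, ← hω]
    rw [h1, hfs]
    refine hlim.congr fun n => ?_
    rw [← hσs, hσh]

theorem IsRobustPerfect.ae_isPureRobustPerfect (hF : F.IsRich) {g : I × Ω → A}
    (hg : IsRobustPerfect F u g) :
    ∀ᵐ ω ∂P, IsPureRobustPerfect F u fun i => g (i, ω) := by
  classical
  obtain ⟨hgs, gs, ε, J, φ, hε0, hE, hε, hJ, hlim⟩ := hg
  obtain ⟨p, hp, hps, hpg⟩ := exists_measurable_law hgs.1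
  choose q hq hqs hqg using fun n => exists_measurable_law (hE n).isStrategyProfile.1
  obtain ⟨σ, hσ, hsum⟩ := hgs.exists_summary_eq
  set c : ℕ → ℝ := fun n => 1 / ((n : ℝ) + 1) with hcdef
  have hc0 : ∀ n, 0 < c n := fun n => by positivity
  have hc1 : ∀ n, c n ≤ 1 := fun n => by
    rw [hcdef]
    exact (div_le_one (by positivity)).2 (by linarith [n.cast_nonneg (α := ℝ)])
  -- Only countably many functionals are involved, so one null set of `ω` serves for all.
  have hT : ∀ᵐ ω ∂P, ∀ n b,
      ∫ i, transition (c n) (p i) (q n i) (g (i, ω)) b ∂lam = ∫ i, q n i b ∂lam := by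
    refine ae_all_iff.2 fun n => ae_all_iff.2 fun b => ?_
    have hmem := fun i => transition_mem_stdSimplex (hps i) (hqs n i) (hc0 n).le (hc1 n)
    filter_upwards [hgs.ae_integral_eq (ψ := fun i a => transition (c n) (p i) (q n i) a b)
      (fun a => measurable_transition hp (hq n) a b) (C := 1) fun i a => by
        rw [abs_of_nonneg ((hmem i a).1 b), ← (hmem i a).2]
        exact Finset.single_le_sum (fun x _ => (hmem i a).1 x) (Finset.mem_univ b)] with ω hω
    rw [hω]
    refine integral_congr_ae ?_
    filter_upwards [hpg] with i hi
    rw [hi]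
    exact sum_mul_transition (hps i) (hqs n i) b
  -- The law of large numbers, applied to the indicator of `p i a = 0`, shows that the players
  -- realizing a null action form a null set.
  have hpos : ∀ᵐ ω ∂P, ∀ᵐ i ∂lam, 0 < p i (g (i, ω)) := by
    have hψ : ∀ a, Measurable fun i => if p i a = 0 then (1 : ℝ) else 0 := fun a =>
      Measurable.ite (measurableSet_eq_fun (measurable_pi_iff.1 hp a) measurable_const)
        measurable_const measurable_const
    filter_upwards [hgs.ae_integral_eq (ψ := fun i a => if p i a = 0 then (1 : ℝ) else 0) hψ
      (C := 1) fun i a => by split_ifs <;> simp, ae_measurable_right hgs.1] with ω hω hm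
    have h0 : ∫ i, ∑ a, actionLaw P g i a * (if p i a = 0 then (1 : ℝ) else 0) ∂lam = 0 := by
      rw [integral_congr_ae (g := fun _ => (0 : ℝ))]
      · simp
      · filter_upwards [hpg] with i hi
        refine Finset.sum_eq_zero fun a _ => ?_
        rw [hi]
        split_ifs with h <;> simp [h]
    rw [h0] at hω
    have hmeas : Measurable fun i => if p i (g (i, ω)) = 0 then (1 : ℝ) else 0 :=
      (measurable_from_prod_countable_right
        (f := fun z : A × I => if p z.2 z.1 = 0 then (1 : ℝ) else 0) hψ).comp
          (hm.prodMk measurable_id)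
    rw [integral_eq_zero_iff_of_nonneg (fun i => by dsimp only; split_ifs <;> simp)
      (Integrable.of_bound hmeas.aestronglyMeasurable 1
        (ae_of_all _ fun i => by split_ifs <;> simp))] at hω
    filter_upwards [hω] with i hi
    refine lt_of_le_of_ne ((hps i).1 _) fun h => ?_
    simp [← h] at hi
  filter_upwards [hT, hpos, hsum, ae_measurable_right hgs.1] with ω hTω hposω hsumω hm
  exact isPureRobustPerfect_of_transition hF hε0 hE hε hJ hlim hc0 hc1
    tendsto_one_div_add_atTop_nhds_zero_nat hp hps hpg hq hqs hqg hm hposω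
    (by rw [hsumω, hσ]) hTω

end Purification

end LargeGame

end

theorem theorem1 {I Ω A : Type*} [MeasurableSpace I] [MeasurableSpace Ω]
    [Fintype A] [Nonempty A] [TopologicalSpace A] [DiscreteTopology A]
    [MeasurableSpace A] [DiscreteMeasurableSpace A]
    (lam : Measure I) [IsProbabilityMeasure lam] [lam.IsComplete]
    (hlam : LargeGame.Atomless lam)
    (P : Measure Ω) [IsProbabilityMeasure P] [P.IsComplete]
    (F : LargeGame.FubiniExtension lam P) (hF : F.IsRich)
    (u : I → LargeGame.Payoff A) (hu : LargeGame.IsLargeGame u)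
    (g : I × Ω → A) (hg : LargeGame.IsRobustPerfect F u g) :
    LargeGame.IsAdmissible F u g ∧
    LargeGame.IsAggregateRobust F u g ∧
    (∀ᵐ ω ∂P, LargeGame.IsPureRobustPerfect F u (fun i => g (i, ω))) ∧
    LargeGame.IsNash F u g := by
  exact ⟨hg.isAdmissible, hg.isAggregateRobust, hg.ae_isPureRobustPerfect hF, hg.isNash⟩
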